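/- Let $p\ge 5$ be an integer. Let $(m_n)_{n\ge 0}$ be the metallic sequence: $m_0=1$, $m_1=p-2$, $m_{n+2}=(p-2)m_{n+1}-m_n$. A metallic code of a positive integer $n$ is a word $a_k\cdots a_1a_0$ with $a_i\in\{0,\dots,p-3\}$, $a_k\neq 0$ and $n=\sum_{i=0}^k a_i m_i$, which contains no factor $\mathbf d\mathbf c^{j}\mathbf d$ ($j\ge 0$), where $\mathbf d=p-3$ and $\mathbf c=p-4$. It exists and is unique; denote it by $[n]$, denote by $(w)$ the number represented by a word $w$, and call the last digit $a_0$ of $[n]$ the signature of $n$. The natural numbering of a rooted tree with finite branching, the sons of each node being ordered from left to right, gives $1$ to the root and then numbers the nodes level by level and, on each level, from left to right. Let $\mathcal B_\rho$ be the black metallic tree under the rightmost assignment $\rho$: its root is black, a black node has $p-3$ sons, a white node has $p-2$ sons, and in both cases the rightmost son is black and all the other sons are white. Identify each node of $\mathcal B_\rho$ with its natural number. A node whose signature is $0$ is called a $0$-node. Let $\mathcal V$ be the set of $0$-nodes of $\mathcal B_\rho$. Then $\nu\mapsto([\nu]0)$ maps the set of nodes of $\mathcal B_\rho$ bijectively onto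 $\mathcal V$, and $[([\nu]0)]=[\nu]0$; let $\varphi:\mathcal V\to\mathcal B_\rho$, $\varphi(([\nu]0))=\nu$, be the inverse bijection. Make $\mathcal V$ a tree with root $([1]0)$ by taking as sons of $([\nu]0)$, from left to right, the sons with signature $0$ of the sons of $\nu$ in $\mathcal B_\rho$. Then $\mathcal V$ is indeed a tree and $\varphi$ is an isomorphism from $\mathcal V$, with its natural numbering, onto $\mathcal B_\rho$: it is a bijection which preserves the natural number, the level and the number of sons of each node, and it maps the sons of $v$ in $\mathcal V$, in order, to the sons of $\varphi(v)$ in $\mathcal B_\rho$. Moreover $\varphi^{-1}$ transports $\rho$ onto $\mathcal V$. That is, the assignment which gives to $v\in\mathcal V$ the status of $\varphi(v)$, the image under $\varphi^{-1}$ of the leftmost son of $\varphi(v)$, and the position of the black son of $\varphi(v)$ among the sons of $\varphi(v)$, is the rightmost assignment of a black metallic tree on $\mathcal V$: the root is black, a node has $p-3$ or $p-2$ sons when it is black or white respectively, and exactly one of its sons, the rightmost one, is black. Under this assignment the status of $v\in\mathcal V$ is the status in $\mathcal B_\rho$ of the father of $v$ in $\mathcal B_\rho$. -/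

import Mathlib

/-- The metallic sequence: `m_0 = 1`, `m_1 = p - 2`, `m_{n+2} = (p - 2) m_{n+1} - m_n`.
For `p ≥ 5` the subtraction is never truncated, see `metallic_add_two`. -/
def metallic (p : ℕ) : ℕ → ℕ
  | 0 => 1
  | 1 => p - 2
  | n + 2 => (p - 2) * metallic p (n + 1) - metallic p n

theorem metallic_le_succ (p : ℕ) (hp : 5 ≤ p) (n : ℕ) : metallic p n ≤ metallic p (n + 1) := by
  induction n with
  | zero => simp only [metallic]; omega
  | succ n ih =>
    have h : 2 * metallic p (n + 1) ≤ (p - 2) * metallic p (n + 1) :=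
      Nat.mul_le_mul_right _ (by omega)
    simp only [metallic]
    omega

theorem metallic_add_two (p : ℕ) (hp : 5 ≤ p) (n : ℕ) :
    metallic p (n + 2) + metallic p n = (p - 2) * metallic p (n + 1) := by
  have h : 2 * metallic p (n + 1) ≤ (p - 2) * metallic p (n + 1) :=
    Nat.mul_le_mul_right _ (by omega)
  have h' := metallic_le_succ p hp n
  simp only [metallic]
  omega

/-- Words `a_k … a_1 a_0` of digits are stored as lists `[a_0, a_1, …, a_k]`, the rightmost digit
first (the convention of `Nat.digits`); this is the number `∑ a_i m_i` they represent. -/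
def wordValue (p : ℕ) (w : List ℕ) : ℕ :=
  (w.mapIdx fun i a => a * metallic p i).sum

/-- `w` is a metallic code of `n`: its digits are in `{0, …, p - 3}`, its leading digit is not `0`,
it does not contain the forbidden pattern `d c* d` with `d = p - 3` and `c = p - 4` (a pattern which
reads the same in both directions), and it represents `n`. -/
structure IsMetallicCode (p n : ℕ) (w : List ℕ) : Prop where
  digit_le : ∀ a ∈ w, a ≤ p - 3
  leading_ne_zero : w.getLast? ≠ some 0
  not_forbidden : ∀ j : ℕ, ¬ ([p - 3] ++ List.replicate j (p - 4) ++ [p - 3]) <:+: w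
  value_eq : wordValue p w = n

/-- The metallic code `[n]` of `n`. -/
noncomputable def metallicCode (p n : ℕ) : List ℕ :=
  Classical.epsilon (IsMetallicCode p n)

/-- `n` has signature `0`: the rightmost digit of `[n]` is `0`. -/
def HasZeroSignature (p n : ℕ) : Prop :=
  (metallicCode p n).head? = some 0

/-- The number `([ν]0)` represented by the word `[ν]0`. -/
noncomputable def appendZero (p ν : ℕ) : ℕ :=
  wordValue p (0 :: metallicCode p ν)

/-- The number represented by the word which is left when the rightmost digit of the code of `v` is
erased. For `v = ([ν]0)` this is `ν`. -/
noncomputable def eraseZero (p v : ℕ) : ℕ :=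
  wordValue p (metallicCode p v).tail

/-- Data of a rooted tree with finite branching, the sons of each node being listed from left
to right. -/
structure PlaneTree (N : Type*) where
  nodes : Set N
  root : N
  sons : N → List N

namespace PlaneTree

variable {N M : Type*}

/-- The nodes at distance `k` from the root, from left to right. -/
def level (T : PlaneTree N) : ℕ → List N
  | 0 => [T.root]
  | k + 1 => (T.level k).flatMap T.sons

/-- The data define a tree: each node is reached from the root, and by one path only. -/
structure IsTree (T : PlaneTree N) : Prop where
  mem_nodes_iff : ∀ v, v ∈ T.nodes ↔ ∃ k, v ∈ T.level k
  nodup_level : ∀ k, (T.level k).Nodup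
  disjoint_level : ∀ j k, j ≠ k → List.Disjoint (T.level j) (T.level k)

/-- The natural numbering: the root receives `1`, and the numbers then go level by level and, on
each level, from left to right. -/
def HasNumber (T : PlaneTree N) (v : N) (n : ℕ) : Prop :=
  ∃ k i : ℕ, (T.level k)[i]? = some v ∧ n = (∑ j ∈ Finset.range k, (T.level j).length) + i + 1

/-- `f` is an isomorphism of numbered trees: a bijection between the nodes of two trees which
preserves the natural numbers, the levels and the numbers of sons. -/
structure IsNumberedIso (T : PlaneTree N) (T' : PlaneTree M) (f : N → M) : Prop where
  isTree_left : T.IsTree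
  isTree_right : T'.IsTree
  bijOn : Set.BijOn f T.nodes T'.nodes
  number : ∀ v ∈ T.nodes, ∀ n, T.HasNumber v n ↔ T'.HasNumber (f v) n
  level : ∀ v ∈ T.nodes, ∀ k, v ∈ T.level k ↔ f v ∈ T'.level k
  sons_length : ∀ v ∈ T.nodes, (T.sons v).length = (T'.sons (f v)).length

end PlaneTree

/-- The literal status of a node. -/
inductive Status
  | black
  | white

/-- The numerical status. -/
def Status.num : Status → ℕ
  | .black => 1
  | .white => 0

/-- An assignment associates with each node its leftmost son, the position of its black son
among its sons (the leftmost position being `1`), and its status. -/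
structure Assignment (N : Type*) where
  leftmost : N → N
  blackPos : N → ℕ
  status : N → Status

namespace Assignment

variable {N M : Type*}

/-- `α` is an assignment on the tree `T`: under `α`, a black node has `p - 3` sons, a white one
has `p - 2` sons, and each node has exactly one black son, at the position given by `α`. -/
structure IsOn (α : Assignment N) (p : ℕ) (T : PlaneTree N) : Prop where
  sons_length : ∀ v ∈ T.nodes, (T.sons v).length = p - 2 - (α.status v).num
  leftmost : ∀ v ∈ T.nodes, (T.sons v).head? = some (α.leftmost v)
  blackPos_mem : ∀ v ∈ T.nodes, α.blackPos v ∈ Set.Icc 1 (p - 2 - (α.status v).num)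
  status_sons : ∀ v ∈ T.nodes, ∀ i u, (T.sons v)[i]? = some u →
    (α.status u = Status.black ↔ i + 1 = α.blackPos v)

/-- `α` is the rightmost assignment on the black metallic tree `T`: its root is black and the black
son of each node is its rightmost son. -/
structure IsBlackRightmost (α : Assignment N) (p : ℕ) (T : PlaneTree N) : Prop where
  isOn : α.IsOn p T
  status_root : α.status T.root = Status.black
  blackPos : ∀ v ∈ T.nodes, α.blackPos v = p - 2 - (α.status v).num

/-- The assignment obtained from `α` when the nodes are transported by `ψ`, whose inverse
is `φ`. -/
def transport (α : Assignment M) (ψ : M → N) (φ : N → M) : Assignment N where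
  leftmost v := ψ (α.leftmost (φ v))
  blackPos v := α.blackPos (φ v)
  status v := α.status (φ v)

end Assignment

/-- The rules for the rightmost assignment, `b → w^{p-4} b` and `w → w^{p-3} b`. -/
def rhoRule (p : ℕ) : Status → List Status
  | .black => List.replicate (p - 4) .white ++ [.black]
  | .white => List.replicate (p - 3) .white ++ [.black]

/-- The statuses of the nodes `1, 2, 3, …` of the black metallic tree under the rightmost
assignment, as far as the sons of the nodes `1, …, k` have been added: at first there is the black
root, and then the nodes receive their sons in turn (node `k + 1` has index `k` in the list). -/
def rhoWord (p : ℕ) : ℕ → List Status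
  | 0 => [.black]
  | k + 1 => rhoWord p k ++ rhoRule p ((rhoWord p k).getD k .white)

/-- The rightmost assignment on the black metallic tree; nodes are given by their numbers. -/
def blackRho (p : ℕ) : Assignment ℕ where
  leftmost ν := (rhoWord p (ν - 1)).length + 1
  blackPos ν := p - 2 - ((rhoWord p (ν - 1)).getD (ν - 1) .white).num
  status ν := (rhoWord p (ν - 1)).getD (ν - 1) .white

/-- The black metallic tree under the rightmost assignment; nodes are given by their numbers. -/
def blackTree (p : ℕ) : PlaneTree ℕ where
  nodes := {ν | 1 ≤ ν}
  root := 1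
  sons ν := List.range' ((blackRho p).leftmost ν) (rhoRule p ((blackRho p).status ν)).length

open Classical in
/-- The tree of the `0`-nodes of the black metallic tree under the rightmost assignment. Its root is
`([1]0)`, and the sons of `([ν]0)` are the `0`-sons of the sons of `ν`, from left to right. -/
noncomputable def zeroTree (p : ℕ) : PlaneTree ℕ where
  nodes := {v | v ∈ (blackTree p).nodes ∧ HasZeroSignature p v}
  root := appendZero p 1
  sons v := ((blackTree p).sons (eraseZero p v)).flatMap fun μ =>
    ((blackTree p).sons μ).filter fun u => HasZeroSignature p u

/-! ### The rightmost assignment -/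

/-! Write Z for `zeroSon`. The theorem rests on the identity Z(n) = ([n]0): appending a zero to the
code of a node gives its rightmost son.

On the tree side, Z(n+1) - Z(n) is p - 3 if n + 1 is a value of Z and p - 2 otherwise
(`zeroSon_succ`), because a node other than the root is black exactly when it is a rightmost son.
Summing these steps, Z(k) ≤ n < Z(k+1) implies Z(n) + k = (p-2)n (`zeroSon_add_eq`). On the code
side, the metallic recurrence gives the same relation between a word, its shift and its truncation
(`shiftedValue_one_cons`). The forbidden pattern allows exactly the last digits a with Z(k) + a <
Z(k+1), so the two recursions agree (`IsAdmissible.shiftedValue_one`).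

Hence the code of n ≥ 1 is the code of k followed by the digit n - Z(k), and the `0`-nodes are the
positive values of Z. Every node has its rightmost son as its only `0`-son
(`filter_blackTree_sons`). The tree of `0`-nodes is therefore the image of the black tree under the
strictly increasing map Z, and the remaining claims are transported along Z. -/

/-- The number of the rightmost son of the node `n` of the black tree; `1` for `n = 0`. -/
def lastSon (p n : ℕ) : ℕ := (rhoWord p n).length

section Rho

variable {p : ℕ}

theorem length_rhoRule (hp : 5 ≤ p) (s : Status) : (rhoRule p s).length = p - 2 - s.num := by
  cases s <;> simp [rhoRule, Status.num] <;> omega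

theorem getElem?_rhoRule (s : Status) {i : ℕ} (hi : i < (rhoRule p s).length) :
    (rhoRule p s)[i]? = some .black ↔ i + 1 = (rhoRule p s).length := by
  cases s <;> simp [rhoRule] at hi ⊢ <;> grind

theorem lastSon_zero : lastSon p 0 = 1 := rfl

theorem rhoWord_prefix {j k : ℕ} (h : j ≤ k) : rhoWord p j <+: rhoWord p k := by
  induction k, h using Nat.le_induction with
  | base => exact List.prefix_rfl
  | succ k _ ih => exact ih.trans (List.prefix_append _ _)

theorem lastSon_succ (hp : 5 ≤ p) (n : ℕ) :
    lastSon p (n + 1) = lastSon p n + (p - 2 - ((blackRho p).status (n + 1)).num) := by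
  simp [lastSon, rhoWord, blackRho, length_rhoRule hp]

theorem Status.num_le (s : Status) : s.num ≤ 1 := by cases s <;> simp [Status.num]

theorem Status.num_eq_one {s : Status} : s.num = 1 ↔ s = .black := by cases s <;> simp [Status.num]

theorem lastSon_strictMono (hp : 5 ≤ p) : StrictMono (lastSon p) := by
  refine strictMono_nat_of_lt_succ fun n => ?_
  have := Status.num_le ((blackRho p).status (n + 1))
  rw [lastSon_succ hp]
  omega

/-- Each node is already listed when its sons are appended, so the default value of `getD` in
`rhoWord` is never read. -/
theorem lt_lastSon (hp : 5 ≤ p) (n : ℕ) : n < lastSon p n := by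
  induction n with
  | zero => simp [lastSon_zero]
  | succ n ih => have := lastSon_strictMono hp (Nat.lt_add_one n); omega

/-- The stages of the construction are prefixes of one another, so the status of a node does not
depend on the stage at which it is read. -/
theorem getElem?_rhoWord (hp : 5 ≤ p) {k ν : ℕ} (hν : 1 ≤ ν) (h : ν ≤ lastSon p k) :
    (rhoWord p k)[ν - 1]? = some ((blackRho p).status ν) := by
  have h1 : ν - 1 < (rhoWord p (ν - 1)).length := lt_lastSon hp _
  have h2 : ν - 1 < (rhoWord p k).length := by unfold lastSon at h; omega
  have key : (rhoWord p k)[ν - 1]? = (rhoWord p (ν - 1))[ν - 1]? := by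
    rcases le_total k (ν - 1) with hk | hk
    · rw [List.getElem?_eq_getElem h1, List.getElem?_eq_getElem h2, (rhoWord_prefix hk).getElem h2]
    · rw [List.getElem?_eq_getElem h1, List.getElem?_eq_getElem h2, (rhoWord_prefix hk).getElem h1]
  rw [key]
  simp [blackRho, List.getD, List.getElem?_eq_getElem h1]

theorem status_eq_black_iff (hp : 5 ≤ p) {n ν : ℕ} (h1 : lastSon p n < ν)
    (h2 : ν ≤ lastSon p (n + 1)) : (blackRho p).status ν = .black ↔ ν = lastSon p (n + 1) := by
  have hν : 1 ≤ ν := by omega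
  have h := getElem?_rhoWord hp hν h2
  rw [rhoWord, List.getElem?_append_right (by unfold lastSon at h1; omega)] at h
  have hl : lastSon p (n + 1) =
      lastSon p n + (rhoRule p ((rhoWord p n).getD n .white)).length := by
    simp [lastSon, rhoWord]
  have := getElem?_rhoRule (p := p) ((rhoWord p n).getD n .white) (i := ν - 1 - lastSon p n)
    (by omega)
  unfold lastSon at this
  rw [h, Option.some_inj] at this
  rw [this, hl]
  unfold lastSon at h1 ⊢
  omega

theorem exists_lastSon_lt_le (hp : 5 ≤ p) {ν : ℕ} (hν : 2 ≤ ν) :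
    ∃ n, lastSon p n < ν ∧ ν ≤ lastSon p (n + 1) := by
  have hex : ∃ n, ν ≤ lastSon p n := ⟨ν, (lt_lastSon hp ν).le⟩
  classical
  obtain ⟨n, hn⟩ : ∃ n, Nat.find hex = n + 1 := Nat.exists_eq_succ_of_ne_zero fun h0 => by
    have := Nat.find_spec hex
    rw [h0, lastSon_zero] at this
    omega
  refine ⟨n, not_le.1 (Nat.find_min hex (by omega)), hn ▸ Nat.find_spec hex⟩

theorem status_one : (blackRho p).status 1 = .black := rfl

end Rho

/-! ### Metallic codes -/

/-- The number `([n]0)`, in terms of the black tree: the rightmost son of `n`, and `0` for `n = 0`. -/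
def zeroSon (p n : ℕ) : ℕ := if n = 0 then 0 else lastSon p n

/-! ### The gaps between consecutive values of `zeroSon` -/

section ZeroSon

variable {p : ℕ}

theorem zeroSon_zero : zeroSon p 0 = 0 := rfl

theorem zeroSon_of_pos {n : ℕ} (h : 1 ≤ n) : zeroSon p n = lastSon p n := if_neg (by omega)

theorem lastSon_one (hp : 5 ≤ p) : lastSon p 1 = p - 2 := by
  rw [lastSon_succ hp, lastSon_zero, status_one]
  simp only [Status.num]
  omega

/-- The value `0` at `0`, instead of `lastSon p 0 = 1`, absorbs the exceptional root: it is black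
without being a rightmost son, yet the first gap is p - 2, in accordance with 1 not being a value.
-/
theorem zeroSon_succ (hp : 5 ≤ p) (n : ℕ) :
    (n + 1 ∈ Set.range (zeroSon p) → zeroSon p (n + 1) = zeroSon p n + (p - 3)) ∧
    (n + 1 ∉ Set.range (zeroSon p) → zeroSon p (n + 1) = zeroSon p n + (p - 2)) := by
  have hs := lastSon_strictMono hp
  rcases Nat.eq_zero_or_pos n with rfl | hn
  · rw [zeroSon_of_pos (n := 0 + 1) le_rfl, zeroSon_zero, lastSon_one hp]
    refine ⟨?_, fun _ => by omega⟩
    rintro ⟨k, hk⟩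
    rcases Nat.eq_zero_or_pos k with rfl | hk0
    · simp [zeroSon_zero] at hk
    · rw [zeroSon_of_pos hk0] at hk
      have := hs.monotone hk0
      rw [Nat.succ_eq_add_one, lastSon_one hp] at this
      omega
  · rw [zeroSon_of_pos (by omega), zeroSon_of_pos hn, lastSon_succ hp]
    obtain ⟨k, h1, h2⟩ := exists_lastSon_lt_le hp (ν := n + 1) (by omega)
    have hb := status_eq_black_iff hp h1 h2
    have hnum := Status.num_le ((blackRho p).status (n + 1))
    constructor
    · rintro ⟨j, hj⟩
      have hj0 : 1 ≤ j := by
        by_contra h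
        rw [show j = 0 by omega, zeroSon_zero] at hj
        omega
      rw [zeroSon_of_pos hj0] at hj
      have hjk : j = k + 1 := by
        rw [← hj] at h1 h2
        have := hs.lt_iff_lt.1 h1
        have := hs.le_iff_le.1 h2
        omega
      rw [Status.num_eq_one.2 (hb.2 (hjk ▸ hj.symm))]
      omega
    · intro h
      have : ((blackRho p).status (n + 1)).num ≠ 1 := fun h' =>
        h ⟨k + 1, (zeroSon_of_pos (by omega)).trans (hb.1 (Status.num_eq_one.1 h')).symm⟩
      omega

theorem zeroSon_add_two_le (hp : 5 ≤ p) (n : ℕ) : zeroSon p n + 2 ≤ zeroSon p (n + 1) := by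
  have := zeroSon_succ hp n
  by_cases h : n + 1 ∈ Set.range (zeroSon p)
  · have := this.1 h; omega
  · have := this.2 h; omega

theorem zeroSon_strictMono (hp : 5 ≤ p) : StrictMono (zeroSon p) :=
  strictMono_nat_of_lt_succ fun n => by have := zeroSon_add_two_le hp n; omega

/-- Provides the descent for codes: if n ≥ 1 and `zeroSon p k ≤ n`, then k < n. -/
theorem two_mul_le_zeroSon (hp : 5 ≤ p) (n : ℕ) : 2 * n ≤ zeroSon p n := by
  induction n with
  | zero => simp
  | succ n ih => have := zeroSon_add_two_le hp n; omega

theorem exists_zeroSon_le_lt (hp : 5 ≤ p) (n : ℕ) :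
    ∃ k, zeroSon p k ≤ n ∧ n < zeroSon p (k + 1) := by
  induction n with
  | zero => exact ⟨0, le_rfl, by have := zeroSon_add_two_le hp 0; omega⟩
  | succ n ih =>
    obtain ⟨k, h1, h2⟩ := ih
    by_cases h : n + 1 < zeroSon p (k + 1)
    · exact ⟨k, by omega, h⟩
    · exact ⟨k + 1, by omega, by have := zeroSon_add_two_le hp (k + 1); omega⟩

theorem eq_of_zeroSon_le_lt (hp : 5 ≤ p) {n j k : ℕ} (hj : zeroSon p j ≤ n)
    (hj' : n < zeroSon p (j + 1)) (hk : zeroSon p k ≤ n) (hk' : n < zeroSon p (k + 1)) : j = k := by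
  have h1 := (zeroSon_strictMono hp).lt_iff_lt.1 (hj.trans_lt hk')
  have h2 := (zeroSon_strictMono hp).lt_iff_lt.1 (hk.trans_lt hj')
  omega

theorem mem_range_zeroSon_iff (hp : 5 ≤ p) {n k : ℕ} (h : zeroSon p k ≤ n)
    (h' : n < zeroSon p (k + 1)) : n ∈ Set.range (zeroSon p) ↔ n = zeroSon p k := by
  refine ⟨?_, fun h => ⟨k, h.symm⟩⟩
  rintro ⟨j, rfl⟩
  rw [eq_of_zeroSon_le_lt hp le_rfl (zeroSon_strictMono hp (Nat.lt_add_one j)) h h']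

theorem succ_mem_range_zeroSon_iff (hp : 5 ≤ p) {n k : ℕ} (h : zeroSon p k ≤ n)
    (h' : n < zeroSon p (k + 1)) : n + 1 ∈ Set.range (zeroSon p) ↔ n + 1 = zeroSon p (k + 1) := by
  refine ⟨fun hr => ?_, fun h => ⟨k + 1, h.symm⟩⟩
  by_contra hne
  have := (mem_range_zeroSon_iff hp (h.trans n.le_succ) (by omega : n + 1 < _)).1 hr
  omega

/-- The recursion by which the number of sons determines the father. -/
theorem zeroSon_add_eq (hp : 5 ≤ p) {n k : ℕ} (h : zeroSon p k ≤ n) (h' : n < zeroSon p (k + 1)) :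
    zeroSon p n + k = (p - 2) * n := by
  induction n generalizing k with
  | zero =>
    have := two_mul_le_zeroSon hp k
    rw [zeroSon_zero]
    omega
  | succ n ih =>
    -- Reaching a value of `zeroSon` raises k by one and shortens the step by one, so the sum grows
    -- by p - 2 in both cases.
    by_cases hr : n + 1 = zeroSon p k
    · obtain ⟨j, rfl⟩ : ∃ j, k = j + 1 := Nat.exists_eq_succ_of_ne_zero fun h0 => by
        rw [h0, zeroSon_zero] at hr
        omega
      have := ih (k := j) (by have := zeroSon_add_two_le hp j; omega) (by omega)
      have := (zeroSon_succ hp n).1 ⟨_, hr.symm⟩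
      rw [Nat.mul_succ]
      omega
    · have := ih (k := k) (by omega) (by omega)
      have := (zeroSon_succ hp n).2 fun h0 => hr ((mem_range_zeroSon_iff hp h h').1 h0)
      rw [Nat.mul_succ]
      omega

end ZeroSon

/-! ### Admissible words, and existence and uniqueness of codes -/

section Code

variable {p : ℕ}

/-- The value of a word which is followed by `s` zeros. -/
def shiftedValue (p : ℕ) : ℕ → List ℕ → ℕ
  | _, [] => 0
  | s, a :: w => a * metallic p s + shiftedValue p (s + 1) w

theorem shiftedValue_eq (s : ℕ) (w : List ℕ) :
    shiftedValue p s w = (w.mapIdx fun i a => a * metallic p (i + s)).sum := by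
  induction w generalizing s with
  | nil => simp [shiftedValue]
  | cons a w ih => simp [shiftedValue, ih, List.mapIdx_cons, Nat.add_assoc, Nat.add_comm 1 s]

theorem wordValue_eq (w : List ℕ) : wordValue p w = shiftedValue p 0 w :=
  (shiftedValue_eq 0 w).symm

theorem wordValue_nil : wordValue p [] = 0 := rfl

theorem wordValue_cons (a : ℕ) (w : List ℕ) :
    wordValue p (a :: w) = a + shiftedValue p 1 w := by
  simp [wordValue_eq, shiftedValue, metallic]

/-- The metallic recurrence passes to words by linearity; the form with sums avoids truncated
subtraction. -/
theorem shiftedValue_add_two (hp : 5 ≤ p) (s : ℕ) (w : List ℕ) :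
    shiftedValue p (s + 2) w + shiftedValue p s w = (p - 2) * shiftedValue p (s + 1) w := by
  induction w generalizing s with
  | nil => simp [shiftedValue]
  | cons a w ih =>
    have h1 := metallic_add_two p hp s
    have h2 := ih (s + 1)
    simp only [shiftedValue, Nat.mul_add, ← h2]
    rw [Nat.mul_left_comm, ← h1]
    ring

theorem shiftedValue_one_cons (hp : 5 ≤ p) (a : ℕ) (w : List ℕ) :
    shiftedValue p 1 (a :: w) + wordValue p w = (p - 2) * wordValue p (a :: w) := by
  have := shiftedValue_add_two hp 0 w
  simp only [zero_add] at this
  rw [wordValue_cons, Nat.mul_add, ← this, wordValue_eq]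
  simp only [shiftedValue, metallic]
  ring

/-- The word `w` ends with `d c^j` for some `j`. -/
def IsFull (p : ℕ) (w : List ℕ) : Prop := ∃ j, List.replicate j (p - 4) ++ [p - 3] <+: w

theorem not_isFull_nil : ¬ IsFull p [] := by simp [IsFull]

theorem isFull_cons (a : ℕ) (w : List ℕ) :
    IsFull p (a :: w) ↔ a = p - 3 ∨ a = p - 4 ∧ IsFull p w := by
  constructor
  · rintro ⟨_ | j, h⟩
    · simp at h
      exact Or.inl h.symm
    · rw [List.replicate_succ, List.cons_append, List.cons_prefix_cons] at h
      exact Or.inr ⟨h.1.symm, j, h.2⟩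
  · rintro (rfl | ⟨rfl, j, h⟩)
    · exact ⟨0, by simp⟩
    · refine ⟨j + 1, ?_⟩
      rw [List.replicate_succ, List.cons_append, List.cons_prefix_cons]
      exact ⟨rfl, h⟩

/-- The digits of `w` are at most `d`, and `w` has no factor `d c^j d`. -/
def IsAdmissible (p : ℕ) (w : List ℕ) : Prop :=
  (∀ a ∈ w, a ≤ p - 3) ∧
    ∀ j : ℕ, ¬ ([p - 3] ++ List.replicate j (p - 4) ++ [p - 3]) <:+: w

theorem isAdmissible_nil : IsAdmissible p [] := by simp [IsAdmissible]

/-- A new forbidden factor must use the new digit, and it exists exactly when this digit is d and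
the old word ends with some d c^j. -/
theorem isAdmissible_cons (a : ℕ) (w : List ℕ) :
    IsAdmissible p (a :: w) ↔ a ≤ p - 3 ∧ ¬ (a = p - 3 ∧ IsFull p w) ∧ IsAdmissible p w := by
  simp only [IsAdmissible, List.forall_mem_cons, List.infix_cons_iff, IsFull, not_or,
    forall_and, List.cons_append, List.nil_append, List.cons_prefix_cons]
  grind

theorem isMetallicCode_iff (n : ℕ) (w : List ℕ) :
    IsMetallicCode p n w ↔ IsAdmissible p w ∧ w.getLast? ≠ some 0 ∧ wordValue p w = n :=
  ⟨fun h => ⟨⟨h.1, h.3⟩, h.2, h.4⟩, fun h => ⟨h.1.1, h.2.1, h.1.2, h.2.2⟩⟩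

/-- Both claims are proved in one induction. Fullness of w tells which gap of `zeroSon` follows its
value, hence how large the next digit may be; the extended word is full exactly when that digit is
the largest possible. -/
theorem IsAdmissible.shiftedValue_one (hp : 5 ≤ p) {w : List ℕ} (hw : IsAdmissible p w) :
    shiftedValue p 1 w = zeroSon p (wordValue p w) ∧
      (IsFull p w ↔ wordValue p w + 1 ∈ Set.range (zeroSon p)) := by
  induction w with
  | nil =>
    refine ⟨rfl, iff_of_false not_isFull_nil ?_⟩
    have h2 := zeroSon_add_two_le hp 0
    rw [wordValue_nil, succ_mem_range_zeroSon_iff hp (n := 0) (k := 0) le_rfl (by omega)]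
    omega
  | cons a w ih =>
    obtain ⟨ha, haf, hw⟩ := (isAdmissible_cons a w).1 hw
    obtain ⟨ih1, ih2⟩ := ih hw
    have hv : wordValue p (a :: w) = a + zeroSon p (wordValue p w) := by
      rw [wordValue_cons, ih1]
    have hz := zeroSon_succ hp (wordValue p w)
    rw [← ih2] at hz
    have hle : zeroSon p (wordValue p w) ≤ wordValue p (a :: w) := by omega
    have hlt : wordValue p (a :: w) < zeroSon p (wordValue p w + 1) := by
      by_cases hf : IsFull p w
      · have := hz.1 hf
        have : a ≠ p - 3 := fun h => haf ⟨h, hf⟩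
        omega
      · have := hz.2 hf
        omega
    constructor
    -- Both relations have the same right side and the same summand `wordValue p w`, which cancels.
    · have := zeroSon_add_eq hp hle hlt
      have := shiftedValue_one_cons hp a w
      omega
    · rw [isFull_cons, succ_mem_range_zeroSon_iff hp hle hlt, hv]
      by_cases hf : IsFull p w
      · have := hz.1 hf
        have : a ≠ p - 3 := fun h => haf ⟨h, hf⟩
        simp only [hf, and_true]
        omega
      · have := hz.2 hf
        simp only [hf, and_false, or_false]
        omega

theorem isAdmissible_cons_iff_lt (hp : 5 ≤ p) {a : ℕ} {w : List ℕ} (hw : IsAdmissible p w) :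
    IsAdmissible p (a :: w) ↔
      a + zeroSon p (wordValue p w) < zeroSon p (wordValue p w + 1) := by
  have hz := zeroSon_succ hp (wordValue p w)
  rw [← (hw.shiftedValue_one hp).2] at hz
  rw [isAdmissible_cons]
  by_cases hf : IsFull p w
  · have := hz.1 hf
    simp only [hf, hw, and_true]
    omega
  · have := hz.2 hf
    simp only [hf, hw, and_true, and_false, not_false_eq_true]
    omega

theorem IsAdmissible.wordValue_cons (hp : 5 ≤ p) {w : List ℕ} (hw : IsAdmissible p w) (a : ℕ) :
    wordValue p (a :: w) = a + zeroSon p (wordValue p w) := by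
  rw [_root_.wordValue_cons, (hw.shiftedValue_one hp).1]

theorem isMetallicCode_nil : IsMetallicCode p 0 [] := by
  simp [isMetallicCode_iff, isAdmissible_nil, wordValue_nil]

theorem IsMetallicCode.tail {n a : ℕ} {w : List ℕ} (h : IsMetallicCode p n (a :: w)) :
    IsMetallicCode p (wordValue p w) w := by
  rw [isMetallicCode_iff] at h ⊢
  refine ⟨((isAdmissible_cons a w).1 h.1).2.2, ?_, rfl⟩
  cases w with
  | nil => simp
  | cons b w => simpa using h.2.1

theorem IsMetallicCode.cons_bounds (hp : 5 ≤ p) {n a : ℕ} {w : List ℕ}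
    (h : IsMetallicCode p n (a :: w)) :
    n = a + zeroSon p (wordValue p w) ∧ n < zeroSon p (wordValue p w + 1) := by
  have hw := ((isMetallicCode_iff _ _).1 h.tail).1
  have h1 := (isAdmissible_cons_iff_lt hp hw).1 ((isMetallicCode_iff _ _).1 h).1
  have h2 := hw.wordValue_cons hp a
  rw [h.value_eq] at h2
  exact ⟨h2, h2 ▸ h1⟩

theorem IsMetallicCode.cons (hp : 5 ≤ p) {n k : ℕ} {w : List ℕ} (hn : 1 ≤ n)
    (h : IsMetallicCode p k w) (h1 : zeroSon p k ≤ n) (h2 : n < zeroSon p (k + 1)) :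
    IsMetallicCode p n ((n - zeroSon p k) :: w) := by
  have hk := h.value_eq
  rw [isMetallicCode_iff] at h ⊢
  rw [isAdmissible_cons_iff_lt hp h.1, h.1.wordValue_cons hp, hk]
  refine ⟨by omega, ?_, by omega⟩
  cases w with
  | nil =>
    -- Here k = 0, so the only digit is n itself, which `hn` makes nonzero.
    rw [wordValue_nil] at hk
    subst hk
    simp [zeroSon_zero]
    omega
  | cons b w => simpa using h.2.1

theorem IsMetallicCode.pos_of_ne_nil (hp : 5 ≤ p) {n : ℕ} {w : List ℕ} (h : IsMetallicCode p n w)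
    (hw : w ≠ []) : 1 ≤ n := by
  induction w generalizing n with
  | nil => exact absurd rfl hw
  | cons a w ih =>
    have hb := (h.cons_bounds hp).1
    rcases eq_or_ne w [] with rfl | hw'
    · have := h.leading_ne_zero
      simp at this
      omega
    · have := ih h.tail hw'
      have := two_mul_le_zeroSon hp (wordValue p w)
      omega

theorem exists_isMetallicCode (hp : 5 ≤ p) (n : ℕ) : ∃ w, IsMetallicCode p n w := by
  induction n using Nat.strong_induction_on with
  | _ n ih =>
    rcases Nat.eq_zero_or_pos n with rfl | hn
    · exact ⟨[], isMetallicCode_nil⟩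
    · obtain ⟨k, h1, h2⟩ := exists_zeroSon_le_lt hp n
      obtain ⟨w, hw⟩ := ih k (by have := two_mul_le_zeroSon hp k; omega)
      exact ⟨_, hw.cons hp hn h1 h2⟩

theorem IsMetallicCode.unique (hp : 5 ≤ p) {n : ℕ} {w w' : List ℕ} (h : IsMetallicCode p n w)
    (h' : IsMetallicCode p n w') : w = w' := by
  induction w generalizing n w' with
  | nil =>
    have h0 : n = 0 := h.value_eq.symm.trans wordValue_nil
    by_contra hne
    have := h'.pos_of_ne_nil hp (Ne.symm hne)
    omega
  | cons a w ih =>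
    have hn := h.pos_of_ne_nil hp (List.cons_ne_nil _ _)
    cases w' with
    | nil =>
      have h0 : n = 0 := h'.value_eq.symm.trans wordValue_nil
      omega
    | cons b w' =>
      have hb := h.cons_bounds hp
      have hb' := h'.cons_bounds hp
      -- Both truncations index the interval between consecutive values of `zeroSon` that contains
      -- n.
      have hk : wordValue p w = wordValue p w' :=
        eq_of_zeroSon_le_lt hp (by omega) hb.2 (by omega) hb'.2
      rw [ih h.tail (hk ▸ h'.tail), show a = b by rw [hk] at hb; omega]

theorem isMetallicCode_metallicCode (hp : 5 ≤ p) (n : ℕ) :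
    IsMetallicCode p n (metallicCode p n) :=
  Classical.epsilon_spec (exists_isMetallicCode hp n)

theorem IsMetallicCode.eq_metallicCode (hp : 5 ≤ p) {n : ℕ} {w : List ℕ}
    (h : IsMetallicCode p n w) : metallicCode p n = w :=
  (isMetallicCode_metallicCode hp n).unique hp h

theorem metallicCode_eq_cons (hp : 5 ≤ p) {n k : ℕ} (hn : 1 ≤ n) (h1 : zeroSon p k ≤ n)
    (h2 : n < zeroSon p (k + 1)) : metallicCode p n = (n - zeroSon p k) :: metallicCode p k :=
  ((isMetallicCode_metallicCode hp k).cons hp hn h1 h2).eq_metallicCode hp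

theorem appendZero_eq (hp : 5 ≤ p) (n : ℕ) : appendZero p n = zeroSon p n := by
  have h := isMetallicCode_metallicCode hp n
  rw [appendZero, ((isMetallicCode_iff _ _).1 h).1.wordValue_cons hp, h.value_eq, zero_add]

theorem hasZeroSignature_iff (hp : 5 ≤ p) {n : ℕ} (hn : 1 ≤ n) :
    HasZeroSignature p n ↔ n ∈ Set.range (zeroSon p) := by
  obtain ⟨k, h1, h2⟩ := exists_zeroSon_le_lt hp n
  rw [HasZeroSignature, metallicCode_eq_cons hp hn h1 h2, mem_range_zeroSon_iff hp h1 h2]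
  simp only [List.head?_cons, Option.some_inj]
  omega

theorem zeroSon_pos (hp : 5 ≤ p) {n : ℕ} (hn : 1 ≤ n) : 1 ≤ zeroSon p n := by
  have := two_mul_le_zeroSon hp n
  omega

theorem metallicCode_zeroSon (hp : 5 ≤ p) {n : ℕ} (hn : 1 ≤ n) :
    metallicCode p (zeroSon p n) = 0 :: metallicCode p n := by
  rw [metallicCode_eq_cons hp (zeroSon_pos hp hn) le_rfl
    (zeroSon_strictMono hp (Nat.lt_add_one n)), Nat.sub_self]

theorem eraseZero_zeroSon (hp : 5 ≤ p) {n : ℕ} (hn : 1 ≤ n) : eraseZero p (zeroSon p n) = n := by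
  rw [eraseZero, metallicCode_zeroSon hp hn, List.tail_cons,
    (isMetallicCode_metallicCode hp n).value_eq]

end Code

/-! ### The black tree -/

section BlackTree

variable {p : ℕ}

theorem blackTree_sons_succ (hp : 5 ≤ p) (n : ℕ) :
    (blackTree p).sons (n + 1) =
      List.range' (lastSon p n + 1) (lastSon p (n + 1) - lastSon p n) := by
  rw [lastSon_succ hp, Nat.add_sub_cancel_left, ← length_rhoRule hp]
  rfl

theorem mem_blackTree_sons_succ (hp : 5 ≤ p) {n u : ℕ} :
    u ∈ (blackTree p).sons (n + 1) ↔ lastSon p n < u ∧ u ≤ lastSon p (n + 1) := by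
  have := lastSon_strictMono hp (Nat.lt_add_one n)
  rw [blackTree_sons_succ hp, List.mem_range'_1]
  omega

/-- The sons of consecutive nodes form adjacent intervals, and their lengths telescope. -/
theorem flatMap_blackTree_sons (hp : 5 ≤ p) (a n : ℕ) :
    (List.range' (a + 1) n).flatMap (blackTree p).sons =
      List.range' (lastSon p a + 1) (lastSon p (a + n) - lastSon p a) := by
  induction n with
  | zero => simp
  | succ n ih =>
    have h1 := (lastSon_strictMono hp).monotone (Nat.le_add_right a n)
    have h2 := lastSon_strictMono hp (Nat.lt_add_one (a + n))
    rw [List.range'_concat, List.flatMap_append, ih, List.flatMap_singleton, one_mul,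
      show a + 1 + n = a + n + 1 by omega, blackTree_sons_succ hp,
      show lastSon p (a + n) + 1 = lastSon p a + 1 + (lastSon p (a + n) - lastSon p a) by omega,
      List.range'_append_1]
    congr 1
    rw [← Nat.add_assoc]
    omega

/-- The number of nodes of the black tree on the levels before the level `k`. -/
def levelEnd (p k : ℕ) : ℕ := (lastSon p)^[k] 0

/-- The last node of a level is the rightmost son of the last node of the level above; starting from
0, the convention `lastSon p 0 = 1` yields the root. -/
theorem levelEnd_succ (k : ℕ) : levelEnd p (k + 1) = lastSon p (levelEnd p k) :=
  Function.iterate_succ_apply' _ _ _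

theorem levelEnd_strictMono (hp : 5 ≤ p) : StrictMono (levelEnd p) :=
  strictMono_nat_of_lt_succ fun k => by rw [levelEnd_succ]; exact lt_lastSon hp _

theorem blackTree_level (hp : 5 ≤ p) (k : ℕ) :
    (blackTree p).level k =
      List.range' (levelEnd p k + 1) (levelEnd p (k + 1) - levelEnd p k) := by
  induction k with
  | zero => simp [PlaneTree.level, blackTree, levelEnd, lastSon_zero]
  | succ k ih =>
    have h := levelEnd_strictMono hp (Nat.lt_add_one k)
    rw [PlaneTree.level, ih, flatMap_blackTree_sons hp, Nat.add_sub_cancel' h.le,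
      ← levelEnd_succ, ← levelEnd_succ]

theorem mem_blackTree_level (hp : 5 ≤ p) {k ν : ℕ} :
    ν ∈ (blackTree p).level k ↔ levelEnd p k < ν ∧ ν ≤ levelEnd p (k + 1) := by
  have := levelEnd_strictMono hp (Nat.lt_add_one k)
  rw [blackTree_level hp, List.mem_range'_1]
  omega

theorem exists_mem_blackTree_level (hp : 5 ≤ p) {ν : ℕ} (hν : 1 ≤ ν) :
    ∃ k, ν ∈ (blackTree p).level k := by
  have hex : ∃ k, ν ≤ levelEnd p k := ⟨ν, (levelEnd_strictMono hp).id_le ν⟩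
  classical
  obtain ⟨k, hk⟩ : ∃ k, Nat.find hex = k + 1 := Nat.exists_eq_succ_of_ne_zero fun h0 => by
    have := Nat.find_spec hex
    rw [h0, levelEnd, Function.iterate_zero_apply] at this
    omega
  exact ⟨k, (mem_blackTree_level hp).2
    ⟨not_le.1 (Nat.find_min hex (by omega)), hk ▸ Nat.find_spec hex⟩⟩

theorem blackTree_isTree (hp : 5 ≤ p) : (blackTree p).IsTree where
  mem_nodes_iff ν := by
    refine ⟨fun h => exists_mem_blackTree_level hp h, fun ⟨k, hk⟩ => ?_⟩
    have := (mem_blackTree_level hp).1 hk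
    exact Nat.one_le_iff_ne_zero.2 (by omega)
  nodup_level k := by rw [blackTree_level hp]; exact List.nodup_range'
  disjoint_level j k hjk ν hj hk := by
    rw [mem_blackTree_level hp] at hj hk
    have h1 := (levelEnd_strictMono hp).lt_iff_lt.1 (hj.1.trans_le hk.2)
    have h2 := (levelEnd_strictMono hp).lt_iff_lt.1 (hk.1.trans_le hj.2)
    omega

theorem sum_length_blackTree_level (hp : 5 ≤ p) (k : ℕ) :
    ∑ j ∈ Finset.range k, ((blackTree p).level j).length = levelEnd p k := by
  induction k with
  | zero => simp [levelEnd]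
  | succ k ih =>
    have := levelEnd_strictMono hp (Nat.lt_add_one k)
    rw [Finset.sum_range_succ, ih, blackTree_level hp, List.length_range']
    omega

theorem blackTree_hasNumber (hp : 5 ≤ p) {ν : ℕ} (hν : 1 ≤ ν) (n : ℕ) :
    (blackTree p).HasNumber ν n ↔ n = ν := by
  constructor
  · rintro ⟨k, i, hi, rfl⟩
    rw [sum_length_blackTree_level hp]
    rw [blackTree_level hp, List.getElem?_eq_some_iff] at hi
    obtain ⟨_, hi⟩ := hi
    rw [List.getElem_range'] at hi
    omega
  · rintro rfl
    obtain ⟨k, hk⟩ := exists_mem_blackTree_level hp hν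
    have h := (mem_blackTree_level hp).1 hk
    refine ⟨k, n - levelEnd p k - 1, ?_, ?_⟩
    · rw [blackTree_level hp, List.getElem?_range' (by omega)]
      congr 1
      omega
    · rw [sum_length_blackTree_level hp]
      omega

theorem blackRho_isBlackRightmost (hp : 5 ≤ p) :
    (blackRho p).IsBlackRightmost p (blackTree p) where
  isOn := {
    sons_length := fun ν _ => by
      rw [blackTree]
      simp only [List.length_range', length_rhoRule hp]
    leftmost := fun ν _ => by
      have := Status.num_le ((blackRho p).status ν)
      simp only [blackTree, length_rhoRule hp]
      rw [show p - 2 - ((blackRho p).status ν).num =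
        (p - 3 - ((blackRho p).status ν).num) + 1 by omega, List.range'_succ, List.head?_cons]
    blackPos_mem := fun ν _ => by
      have := Status.num_le ((blackRho p).status ν)
      exact ⟨(by omega : 1 ≤ p - 2 - ((blackRho p).status ν).num), le_rfl⟩
    status_sons := fun ν hν i u hu => by
      obtain ⟨n, rfl⟩ : ∃ n, ν = n + 1 := Nat.exists_eq_add_of_le' hν
      have hmem := (mem_blackTree_sons_succ hp).1 (List.mem_of_getElem? hu)
      rw [blackTree_sons_succ hp, List.getElem?_eq_some_iff] at hu
      obtain ⟨_, hu⟩ := hu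
      rw [List.getElem_range'] at hu
      rw [status_eq_black_iff hp hmem.1 hmem.2, lastSon_succ hp, ← hu]
      change _ ↔ i + 1 = p - 2 - ((blackRho p).status (n + 1)).num
      omega }
  status_root := rfl
  blackPos _ _ := rfl

end BlackTree

/-! ### The tree of the `0`-nodes -/

section ZeroTree

variable {p : ℕ}

theorem mem_zeroTree_nodes (hp : 5 ≤ p) {v : ℕ} :
    v ∈ (zeroTree p).nodes ↔ ∃ ν, 1 ≤ ν ∧ zeroSon p ν = v := by
  constructor
  · rintro ⟨h1, h2⟩
    obtain ⟨ν, rfl⟩ := (hasZeroSignature_iff hp h1).1 h2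
    refine ⟨ν, Nat.one_le_iff_ne_zero.2 ?_, rfl⟩
    rintro rfl
    exact absurd h1 (by simp [blackTree, zeroSon_zero])
  · rintro ⟨ν, hν, rfl⟩
    exact ⟨zeroSon_pos hp hν, (hasZeroSignature_iff hp (zeroSon_pos hp hν)).2 ⟨ν, rfl⟩⟩

open Classical in
-- The sons of n + 1 fill the interval from `lastSon p n + 1` to `lastSon p (n + 1)`, and strict
-- monotonicity leaves the right end as its only value of `zeroSon`.
theorem filter_blackTree_sons (hp : 5 ≤ p) {μ : ℕ} (hμ : 1 ≤ μ) :
    (((blackTree p).sons μ).filter fun u => HasZeroSignature p u) = [zeroSon p μ] := by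
  obtain ⟨n, rfl⟩ : ∃ n, μ = n + 1 := Nat.exists_eq_add_of_le' hμ
  have h := lastSon_strictMono hp (Nat.lt_add_one n)
  obtain ⟨l, hl⟩ : ∃ l, lastSon p (n + 1) - lastSon p n = l + 1 :=
    Nat.exists_eq_add_of_le' (by omega)
  have hlast : lastSon p n + 1 + 1 * l = zeroSon p (n + 1) := by
    rw [zeroSon_of_pos hμ]
    omega
  rw [blackTree_sons_succ hp, hl, List.range'_concat, List.filter_append, hlast,
    List.filter_eq_nil_iff.2, List.nil_append, List.filter_singleton]
  · simp [hasZeroSignature_iff hp (zeroSon_pos hp hμ)]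
  · intro u hu
    rw [List.mem_range'_1] at hu
    rw [decide_eq_true_eq, hasZeroSignature_iff hp (by omega)]
    rintro ⟨k, rfl⟩
    have hk : 1 ≤ k := Nat.one_le_iff_ne_zero.2 fun h0 => by
      rw [h0, zeroSon_zero] at hu
      omega
    rw [zeroSon_of_pos hk] at hu
    have h1 := (lastSon_strictMono hp).lt_iff_lt.1 (by omega : lastSon p n < lastSon p k)
    have h2 := (lastSon_strictMono hp).lt_iff_lt.1 (by omega : lastSon p k < lastSon p (n + 1))
    omega

theorem one_le_of_mem_blackTree_sons {μ ν : ℕ} (h : μ ∈ (blackTree p).sons ν) : 1 ≤ μ := by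
  simp only [blackTree, blackRho, List.mem_range'_1] at h
  omega

theorem zeroTree_sons_zeroSon (hp : 5 ≤ p) {ν : ℕ} (hν : 1 ≤ ν) :
    (zeroTree p).sons (zeroSon p ν) = ((blackTree p).sons ν).map (zeroSon p) := by
  simp only [zeroTree, eraseZero_zeroSon hp hν]
  rw [List.map_eq_flatMap]
  exact List.flatMap_congr fun μ hμ =>
    filter_blackTree_sons hp (one_le_of_mem_blackTree_sons hμ)

theorem one_le_of_mem_blackTree_level (hp : 5 ≤ p) {k ν : ℕ} (h : ν ∈ (blackTree p).level k) :
    1 ≤ ν :=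
  ((blackTree_isTree hp).mem_nodes_iff ν).2 ⟨k, h⟩

theorem zeroTree_level (hp : 5 ≤ p) (k : ℕ) :
    (zeroTree p).level k = ((blackTree p).level k).map (zeroSon p) := by
  induction k with
  | zero => simp [PlaneTree.level, zeroTree, blackTree, appendZero_eq hp]
  | succ k ih =>
    rw [PlaneTree.level, ih, PlaneTree.level, List.flatMap_map, List.map_flatMap]
    exact List.flatMap_congr fun ν hν =>
      zeroTree_sons_zeroSon hp (one_le_of_mem_blackTree_level hp hν)

theorem zeroSon_mem_zeroTree_level (hp : 5 ≤ p) {k ν : ℕ} :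
    zeroSon p ν ∈ (zeroTree p).level k ↔ ν ∈ (blackTree p).level k := by
  rw [zeroTree_level hp, List.mem_map_of_injective (zeroSon_strictMono hp).injective]

theorem zeroTree_isTree (hp : 5 ≤ p) : (zeroTree p).IsTree where
  mem_nodes_iff v := by
    rw [mem_zeroTree_nodes hp]
    constructor
    · rintro ⟨ν, hν, rfl⟩
      simp only [zeroSon_mem_zeroTree_level hp]
      exact exists_mem_blackTree_level hp hν
    · rintro ⟨k, hk⟩
      rw [zeroTree_level hp, List.mem_map] at hk
      obtain ⟨ν, hν, rfl⟩ := hk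
      exact ⟨ν, one_le_of_mem_blackTree_level hp hν, rfl⟩
  nodup_level k := by
    rw [zeroTree_level hp]
    exact ((blackTree_isTree hp).nodup_level k).map (zeroSon_strictMono hp).injective
  disjoint_level j k hjk v hj hk := by
    rw [zeroTree_level hp, List.mem_map] at hj
    obtain ⟨ν, hν, rfl⟩ := hj
    exact (blackTree_isTree hp).disjoint_level j k hjk hν ((zeroSon_mem_zeroTree_level hp).1 hk)

/-- Numbers depend only on the ordered levels, which correspond under the injective map `zeroSon`.
-/
theorem zeroTree_hasNumber (hp : 5 ≤ p) (ν n : ℕ) :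
    (zeroTree p).HasNumber (zeroSon p ν) n ↔ (blackTree p).HasNumber ν n := by
  simp only [PlaneTree.HasNumber, zeroTree_level hp, List.length_map, List.getElem?_map,
    Option.map_eq_some_iff, (zeroSon_strictMono hp).injective.eq_iff, exists_eq_right]

theorem zeroTree_isNumberedIso (hp : 5 ≤ p) :
    PlaneTree.IsNumberedIso (zeroTree p) (blackTree p) (eraseZero p) where
  isTree_left := zeroTree_isTree hp
  isTree_right := blackTree_isTree hp
  bijOn := by
    refine ⟨fun v hv => ?_, fun v hv w hw h => ?_, fun ν hν => ?_⟩
    · obtain ⟨ν, hν, rfl⟩ := (mem_zeroTree_nodes hp).1 hv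
      rwa [eraseZero_zeroSon hp hν]
    · obtain ⟨ν, hν, rfl⟩ := (mem_zeroTree_nodes hp).1 hv
      obtain ⟨μ, hμ, rfl⟩ := (mem_zeroTree_nodes hp).1 hw
      rw [eraseZero_zeroSon hp hν, eraseZero_zeroSon hp hμ] at h
      rw [h]
    · exact ⟨zeroSon p ν, (mem_zeroTree_nodes hp).2 ⟨ν, hν, rfl⟩, eraseZero_zeroSon hp hν⟩
  number v hv n := by
    obtain ⟨ν, hν, rfl⟩ := (mem_zeroTree_nodes hp).1 hv
    rw [eraseZero_zeroSon hp hν, zeroTree_hasNumber hp]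
  level v hv k := by
    obtain ⟨ν, hν, rfl⟩ := (mem_zeroTree_nodes hp).1 hv
    rw [eraseZero_zeroSon hp hν, zeroSon_mem_zeroTree_level hp]
  sons_length v hv := by
    obtain ⟨ν, hν, rfl⟩ := (mem_zeroTree_nodes hp).1 hv
    rw [eraseZero_zeroSon hp hν, zeroTree_sons_zeroSon hp hν, List.length_map]

theorem map_eraseZero_zeroTree_sons (hp : 5 ≤ p) {v : ℕ} (hv : v ∈ (zeroTree p).nodes) :
    ((zeroTree p).sons v).map (eraseZero p) = (blackTree p).sons (eraseZero p v) := by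
  obtain ⟨ν, hν, rfl⟩ := (mem_zeroTree_nodes hp).1 hv
  rw [eraseZero_zeroSon hp hν, zeroTree_sons_zeroSon hp hν, List.map_map]
  exact (List.map_congr_left fun μ hμ =>
    eraseZero_zeroSon hp (one_le_of_mem_blackTree_sons hμ)).trans (List.map_id' _)

theorem transport_isBlackRightmost (hp : 5 ≤ p) :
    ((blackRho p).transport (appendZero p) (eraseZero p)).IsBlackRightmost p (zeroTree p) where
  isOn := {
    sons_length := fun v hv => by
      rw [(zeroTree_isNumberedIso hp).sons_length v hv]
      exact (blackRho_isBlackRightmost hp).isOn.sons_length _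
        ((zeroTree_isNumberedIso hp).bijOn.mapsTo hv)
    leftmost := fun v hv => by
      have h := (blackRho_isBlackRightmost hp).isOn.leftmost _
        ((zeroTree_isNumberedIso hp).bijOn.mapsTo hv)
      obtain ⟨ν, hν, rfl⟩ := (mem_zeroTree_nodes hp).1 hv
      simp only [Assignment.transport, appendZero_eq hp]
      rw [eraseZero_zeroSon hp hν] at h ⊢
      rw [zeroTree_sons_zeroSon hp hν, List.head?_map, h, Option.map_some]
    blackPos_mem := fun v hv =>
      (blackRho_isBlackRightmost hp).isOn.blackPos_mem _
        ((zeroTree_isNumberedIso hp).bijOn.mapsTo hv)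
    status_sons := fun v hv i u hu =>
      (blackRho_isBlackRightmost hp).isOn.status_sons _
        ((zeroTree_isNumberedIso hp).bijOn.mapsTo hv) i _ (by
          rw [← map_eraseZero_zeroTree_sons hp hv, List.getElem?_map, hu, Option.map_some]) }
  status_root := by
    simp only [Assignment.transport, zeroTree, appendZero_eq hp]
    rw [eraseZero_zeroSon hp le_rfl, status_one]
  blackPos _ _ := rfl

/-- The father of `zeroSon p ν` is ν, which is also its image under `eraseZero`. -/
theorem transport_status_eq (hp : 5 ≤ p) {v μ : ℕ} (hv : v ∈ (zeroTree p).nodes) (hμ : 1 ≤ μ)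
    (h : v ∈ (blackTree p).sons μ) :
    ((blackRho p).transport (appendZero p) (eraseZero p)).status v = (blackRho p).status μ := by
  obtain ⟨ν, hν, rfl⟩ := (mem_zeroTree_nodes hp).1 hv
  obtain ⟨n, rfl⟩ : ∃ n, μ = n + 1 := Nat.exists_eq_add_of_le' hμ
  rw [mem_blackTree_sons_succ hp, zeroSon_of_pos hν, (lastSon_strictMono hp).lt_iff_lt,
    (lastSon_strictMono hp).le_iff_le] at h
  simp only [Assignment.transport]
  rw [eraseZero_zeroSon hp hν, show ν = n + 1 by omega]

end ZeroTree

theorem mainTheorem10 (p : ℕ) (hp : 5 ≤ p) :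
    -- each node has one metallic code
    (∀ ν, 1 ≤ ν → ∃! w, IsMetallicCode p ν w) ∧
    -- the black tree is a tree, with its natural numbering and its rightmost assignment
    (blackTree p).IsTree ∧
    (∀ ν ∈ (blackTree p).nodes, ∀ n, (blackTree p).HasNumber ν n ↔ n = ν) ∧
    (blackRho p).IsBlackRightmost p (blackTree p) ∧
    -- `([ν]0)` is a node of the tree of `0`-nodes, with code `[ν]0`, and its image is `ν`
    (∀ ν ∈ (blackTree p).nodes, appendZero p ν ∈ (zeroTree p).nodes ∧
      metallicCode p (appendZero p ν) = 0 :: metallicCode p ν ∧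
      eraseZero p (appendZero p ν) = ν) ∧
    -- the map is an isomorphism of numbered trees, and maps sons to sons
    PlaneTree.IsNumberedIso (zeroTree p) (blackTree p) (eraseZero p) ∧
    (∀ v ∈ (zeroTree p).nodes,
      ((zeroTree p).sons v).map (eraseZero p) = (blackTree p).sons (eraseZero p v)) ∧
    -- its inverse transports the rightmost assignment to the rightmost assignment, under which
    -- the status of a `0`-node is the status of its father in the black tree
    ((blackRho p).transport (appendZero p) (eraseZero p)).IsBlackRightmost p (zeroTree p) ∧
    (∀ v ∈ (zeroTree p).nodes, ∀ μ ∈ (blackTree p).nodes, v ∈ (blackTree p).sons μ →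
      ((blackRho p).transport (appendZero p) (eraseZero p)).status v = (blackRho p).status μ) := by
  refine ⟨fun ν _ => ?_, blackTree_isTree hp, fun ν hν n => blackTree_hasNumber hp hν n,
    blackRho_isBlackRightmost hp, fun ν hν => ?_, zeroTree_isNumberedIso hp,
    fun v hv => map_eraseZero_zeroTree_sons hp hv, transport_isBlackRightmost hp,
    fun v hv μ hμ h => transport_status_eq hp hv hμ h⟩
  · obtain ⟨w, hw⟩ := exists_isMetallicCode hp ν
    exact ⟨w, hw, fun w' hw' => hw'.unique hp hw⟩
  · rw [appendZero_eq hp]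
    exact ⟨(mem_zeroTree_nodes hp).2 ⟨ν, hν, rfl⟩, metallicCode_zeroSon hp hν,
      eraseZero_zeroSon hp hν⟩
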